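/- **Theorem 2.** Let $G=(V,E)$ be a finite directed graph with a source $s$ and a destination $t\neq s$, and let $\mathrm{conf}:E\to[0,1]$ be confidence scores. Let $P$ be the set of simple $s$–$t$ paths of $G$, i.e. of edge sequences $\langle (s,v_1),(v_1,v_2),\dots,(v_{k-1},t)\rangle$ in which no edge is repeated; assume that $P\ne\emptyset$ and $\sum_{e\in p}\mathrm{conf}(e)>0$ for every $p\in P$. In each round a policy proposes a path $p\in P$ and an administrator selects an edge $e\in p$ to be removed, with probability $$\Pr(e\mid p)=\frac{\mathrm{conf}(e)}{\sum_{e'\in p}\mathrm{conf}(e')},$$ independently of the earlier answers. The policy is adaptive: its choice may depend on all paths proposed and answers received so far, and it proposes a path that was not proposed before. The process stops as soon as the set $C$ of removed edges is an $s$–$t$ cut (it meets every path in $P$), or when $B$ queries have been made. For a set $C$ of removed edges let $g(C)$ be the number of paths in $P$ that contain an edge of $C$. The greedy policy APP proposes in each round, among the paths in $P$ that have not been proposed yet, one that maximises the expected marginal benefit $$\Delta(p\mid C)=\sum_{e\in p}\Pr(e\mid p)\,\bigl[g(C\cup\{e\})-g(C)\bigr],$$ with ties broken arbitrarily. Then,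 for the budget $B=|P|$, the expected number of queries of the greedy policy is at most $$\bigl(\ln|P|+1\bigr)^2$$ times the expected number of queries of every such adaptive policy; in particular, it is at most $(\ln|P|+1)^2$ times the optimal expected number of queries over the policies that in each round propose an $s$–$t$ path of the current graph $(V,E\setminus C)$. -/

import Mathlib

/-- A directed attack graph with edge type `E` (parallel edges are allowed; an ordinary directed
graph is the case in which `e ↦ (src e, tgt e)` is injective), a source `s`, a destination `t`
and a confidence score on the edges. -/
structure AttackGraph (V E : Type*) where
  /-- tail of an edge -/
  src : E → V
  /-- head of an edge -/
  tgt : E → V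
  /-- source node -/
  s : V
  /-- destination node -/
  t : V
  /-- confidence score -/
  conf : E → ℝ

namespace AttackGraph

variable {V E : Type*} (G : AttackGraph V E)

/-- `G.IsWalk u v l`: the edges of the list `l` lead, head to tail, from `u` to `v`. -/
def IsWalk : V → V → List E → Prop
  | u, v, [] => u = v
  | u, v, e :: l => G.src e = u ∧ IsWalk (G.tgt e) v l

/-- A simple path: a sequence of edges leading from `s` to `t` in which no edge is repeated. -/
def SimplePath : Type _ := {l : List E // G.IsWalk G.s G.t l ∧ l.Nodup}

variable {G} in
/-- The set of edges of a simple path. -/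
def SimplePath.edges [DecidableEq E] (p : G.SimplePath) : Finset E := p.1.toFinset

variable [Fintype E]

noncomputable instance : DecidableEq G.SimplePath := Classical.decEq _

instance : Finite G.SimplePath :=
  Finite.of_injective
    (fun p : G.SimplePath => (⟨p.1, p.2.2⟩ : {l : List E // l.Nodup}))
    (fun _ _ h => Subtype.ext (congrArg (fun x : {l : List E // l.Nodup} => x.1) h))

noncomputable instance : Fintype G.SimplePath := Fintype.ofFinite _

variable [DecidableEq E]

/-- Bradley-Terry model: the probability that the administrator removes the edge `e` when the
path `p` is proposed. -/
noncomputable def edgeProb (p : G.SimplePath) (e : E) : ℝ :=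
  G.conf e / ∑ e' ∈ p.edges, G.conf e'

/-- A state of the process, recorded as a partial realization: `ψ p = none` if `p` has not been
proposed yet, and `ψ p = some e` if `p` has been proposed and the administrator answered with the
edge `e` of `p`. -/
abbrev State : Type _ := (p : G.SimplePath) → Option p.edges

/-- The root state: nothing has been proposed. -/
def root : G.State := fun _ => none

variable {G}

open Classical in
/-- The edges removed so far (the range of the partial realization). -/
noncomputable def removed (ψ : G.State) : Finset E :=
  Finset.univ.filter fun e => ∃ p : G.SimplePath, ∃ x : p.edges, ψ p = some x ∧ (x : E) = e

variable (G)

/-- `C` is an `(s, t)`-cut: it meets every path from `s` to `t`, so none is left without `C`. -/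
def IsCut (C : Finset E) : Prop := ∀ p : G.SimplePath, ∃ e ∈ p.edges, e ∈ C

open Classical in
/-- `h e`: the paths that contain the edge `e`. -/
noncomputable def pathsThrough (e : E) : Finset G.SimplePath :=
  Finset.univ.filter fun p => e ∈ p.edges

/-- The utility: the number of paths destroyed by removing the edges in `C`. -/
noncomputable def utility (C : Finset E) : ℕ := (C.biUnion G.pathsThrough).card

variable {G}

/-- The expected marginal benefit of proposing `p` in the state `ψ`. -/
noncomputable def gain (ψ : G.State) (p : G.SimplePath) : ℝ :=
  ∑ e ∈ p.edges, G.edgeProb p e *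
    ((G.utility (insert e (removed ψ)) : ℝ) - (G.utility (removed ψ) : ℝ))

variable (G)

/-- An adaptive policy chooses the next path from the observations made so far. -/
abbrev Policy : Type _ := G.State → G.SimplePath

variable {G}

/-- As long as there is no cut, the policy proposes a path that has not been proposed before. -/
def Policy.IsAdmissible (π : G.Policy) : Prop :=
  ∀ ψ : G.State, ¬ G.IsCut (removed ψ) → ψ (π ψ) = none

/-- As long as there is no cut, the policy proposes a path of the current graph, i.e. one that
contains no removed edge. -/
def Policy.ProposesSurvivingPaths (π : G.Policy) : Prop :=
  ∀ ψ : G.State, ¬ G.IsCut (removed ψ) → ∀ e ∈ (π ψ).edges, e ∉ removed ψ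

/-- Policies that propose only paths of the current graph never repeat a path. -/
theorem Policy.ProposesSurvivingPaths.isAdmissible {π : G.Policy}
    (h : π.ProposesSurvivingPaths) : π.IsAdmissible := by
  intro ψ hψ
  by_contra hne
  obtain ⟨x, hx⟩ := Option.ne_none_iff_exists'.mp hne
  exact h ψ hψ x x.2 (by simpa [removed] using ⟨π ψ, x.2, by simpa using hx⟩)

/-- The greedy policy: as long as there is no cut, it proposes, among the paths that have not been
proposed before, one of maximal expected marginal benefit (ties are broken arbitrarily). -/
def Policy.IsGreedy (π : G.Policy) : Prop :=
  ∀ ψ : G.State, ¬ G.IsCut (removed ψ) →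
    ψ (π ψ) = none ∧ ∀ p : G.SimplePath, ψ p = none → gain ψ p ≤ gain ψ (π ψ)

open Classical in
/-- The expected number of queries that the policy makes from the state `ψ` on, when `B` queries
are left: the process stops when the removed edges form a cut or when the budget is used up;
otherwise one query is made and answered according to the Bradley-Terry model. -/
noncomputable def Policy.expectedQueries (π : G.Policy) : ℕ → G.State → ℝ
  | 0, _ => 0
  | B + 1, ψ =>
    if G.IsCut (removed ψ) then 0
    else 1 + ∑ x : (π ψ).edges, G.edgeProb (π ψ) x *
      Policy.expectedQueries π B (Function.update ψ (π ψ) (some x))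

end AttackGraph

/-!
The proof gives the factor `ln |P| + 1`, which is at least `1` and so at most its square.

Draw all answers in advance: `φ p` is the edge that the administrator removes if `p` is ever
proposed, the `φ p` being independent (`Answers.prob`). Both policies can be run on the same `φ`,
and the expected number of queries of a policy is the average over `φ`.

The greedy policy pays, for the query made in the state `ψ`, the price `1 / gain` for every path
that it destroys; in expectation it pays `1` per query (`sum_prob_mul_total_payment`). Prices
increase along a run, because the gains decrease (submodularity, `gain_update_le`). Summation by
parts writes the total payment as the sum, over the successive price increments, of the increment
times the number of paths that are still alive. The answers which the other policy `σ` gets on the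
same `φ` form a cut, so the number of paths alive in a state is at most the sum, over the paths `j`
proposed by `σ`, of the number of paths that the answer `φ j` would destroy in that state
(`card_sub_utility_le`). The payment is thus distributed over the paths `j` proposed by `σ`, each of
which receives the charge `charge j` (`total_payment_sub_le`).

It remains to bound the expected charge of `j`. Whether `σ` proposes `j` does not depend on `φ j`
(`proposed_update`), nor does the greedy run before it proposes `j`, and afterwards `j` is charged
nothing. Hence one may average over `φ j` alone (`sum_prob_resample`): an increment from the price
`c` to the price `θ` then contributes `(θ - c) * gain ψ j`, which is at most `(θ - c) / θ` because
the greedy policy preferred a path of gain `1 / θ`. This is at most `1` for the first increment,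
where `c = 0`, and at most `ln θ - ln c` for the later ones. As prices lie between `1 / |P|` and
`1`, the sum is at most `1 + ln |P|` (`sum_charge_root_le`).
-/

open Finset

/-! ### Resampling one coordinate of a product distribution -/

/-- In a product of finite probability distributions `q i`, replacing one coordinate by an
independent copy does not change an expectation. -/
theorem sum_prod_mul_resample {ι : Type*} [Fintype ι] [DecidableEq ι] {α : ι → Type*}
    [∀ i, Fintype (α i)] (q : ∀ i, α i → ℝ) (hq : ∀ i, ∑ x, q i x = 1) (j : ι)
    (F : (∀ i, α i) → ℝ) :
    ∑ φ : ∀ i, α i, (∏ i, q i (φ i)) * F φ =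
      ∑ φ : ∀ i, α i, (∏ i, q i (φ i)) * ∑ x, q j x * F (Function.update φ j x) := by
  have h1 : ∑ φ : ∀ i, α i, (∏ i, q i (φ i)) * F φ =
      ∑ y : (∀ i, α i) × α j, (∏ i, q i (y.1 i)) * q j y.2 * F y.1 := by
    rw [Fintype.sum_prod_type]
    refine Finset.sum_congr rfl fun φ _ => ?_
    dsimp only
    rw [← Finset.sum_mul, ← Finset.mul_sum, hq, mul_one]
  have h2 : ∑ φ : ∀ i, α i, (∏ i, q i (φ i)) * ∑ x, q j x * F (Function.update φ j x) =
      ∑ y : (∀ i, α i) × α j,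
        (∏ i, q i (y.1 i)) * q j y.2 * F (Function.update y.1 j y.2) := by
    rw [Fintype.sum_prod_type]
    refine Finset.sum_congr rfl fun φ _ => ?_
    rw [Finset.mul_sum]
    exact Finset.sum_congr rfl fun x _ => by ring
  rw [h1, h2]
  -- exchanging the `j`-th coordinate with the fresh copy is an involution that preserves weights
  have hinv : Function.Involutive
      (fun y : (∀ i, α i) × α j => (Function.update y.1 j y.2, y.1 j)) := by
    rintro ⟨φ, x⟩
    simp
  refine (Fintype.sum_equiv hinv.toPerm _ _ fun y => ?_).symm
  obtain ⟨φ, x⟩ := y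
  simp only [Function.Involutive.coe_toPerm]
  congr 1
  rw [← Finset.mul_prod_erase univ _ (mem_univ j),
    ← Finset.mul_prod_erase univ (fun i => q i (Function.update φ j x i)) (mem_univ j)]
  have : ∏ i ∈ univ.erase j, q i (Function.update φ j x i) = ∏ i ∈ univ.erase j, q i (φ i) :=
    Finset.prod_congr rfl fun i hi => by rw [Function.update_of_ne (Finset.ne_of_mem_erase hi)]
  rw [this, Function.update_self]
  ring

namespace AttackGraph

variable {V E : Type*} [DecidableEq E] {G : AttackGraph V E}

/-! ### The distribution of a single answer -/

theorem sum_edgeProb (hpos : ∀ p : G.SimplePath, 0 < ∑ e ∈ p.edges, G.conf e)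
    (p : G.SimplePath) : ∑ x : p.edges, G.edgeProb p x = 1 := by
  rw [Finset.sum_coe_sort p.edges fun e => G.edgeProb p e]
  simp only [edgeProb]
  rw [← Finset.sum_div, div_self (hpos p).ne']

theorem edgeProb_nonneg (hconf : ∀ e : E, 0 ≤ G.conf e) (p : G.SimplePath) (e : E) :
    0 ≤ G.edgeProb p e :=
  div_nonneg (hconf e) (Finset.sum_nonneg fun e _ => hconf e)

variable [Fintype E]

/-! ### The utility and its marginals -/

/-- The number of surviving paths that the removal of `e` destroys when `C` has been removed. -/
noncomputable def marginal (G : AttackGraph V E) (C : Finset E) (e : E) : ℝ :=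
  (G.utility (insert e C) : ℝ) - G.utility C

theorem marginal_eq_card (C : Finset E) (e : E) :
    G.marginal C e = ((G.pathsThrough e \ C.biUnion G.pathsThrough).card : ℝ) := by
  have : G.utility (insert e C) =
      (G.pathsThrough e \ C.biUnion G.pathsThrough).card + G.utility C := by
    rw [utility, utility, Finset.biUnion_insert, ← Finset.card_sdiff_add_card]
  rw [marginal, this]
  push_cast
  ring

theorem marginal_nonneg (C : Finset E) (e : E) : 0 ≤ G.marginal C e := by
  rw [marginal_eq_card]
  positivity

theorem marginal_le_card (C : Finset E) (e : E) :
    G.marginal C e ≤ Fintype.card G.SimplePath := by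
  rw [marginal_eq_card]
  exact_mod_cast Finset.card_le_univ _

theorem marginal_anti {C D : Finset E} (h : C ⊆ D) (e : E) :
    G.marginal D e ≤ G.marginal C e := by
  rw [marginal_eq_card, marginal_eq_card]
  exact_mod_cast Finset.card_le_card
    (Finset.sdiff_subset_sdiff subset_rfl (Finset.biUnion_subset_biUnion_of_subset_left _ h))

theorem marginal_of_mem {C : Finset E} {e : E} (h : e ∈ C) : G.marginal C e = 0 := by
  rw [marginal, Finset.insert_eq_of_mem h, sub_self]

theorem mem_biUnion_pathsThrough {C : Finset E} {p : G.SimplePath} :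
    p ∈ C.biUnion G.pathsThrough ↔ ∃ e ∈ p.edges, e ∈ C := by
  simp only [Finset.mem_biUnion, pathsThrough, Finset.mem_filter, Finset.mem_univ, true_and]
  exact ⟨fun ⟨e, h1, h2⟩ => ⟨e, h2, h1⟩, fun ⟨e, h1, h2⟩ => ⟨e, h2, h1⟩⟩

theorem one_le_marginal {C : Finset E} {p : G.SimplePath} (hp : ∀ e ∈ p.edges, e ∉ C) {e : E}
    (he : e ∈ p.edges) : 1 ≤ G.marginal C e := by
  rw [marginal_eq_card]
  have : p ∈ G.pathsThrough e \ C.biUnion G.pathsThrough := by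
    rw [Finset.mem_sdiff, mem_biUnion_pathsThrough]
    refine ⟨by simpa [pathsThrough] using he, ?_⟩
    rintro ⟨f, h1, h2⟩
    exact hp f h1 h2
  exact_mod_cast Finset.card_pos.mpr ⟨p, this⟩

theorem utility_of_isCut {C : Finset E} (h : G.IsCut C) :
    G.utility C = Fintype.card G.SimplePath := by
  rw [utility, ← Finset.card_univ]
  congr 1
  exact Finset.eq_univ_of_forall fun p => mem_biUnion_pathsThrough.mpr (h p)

/-! ### States -/

theorem mem_removed {ψ : G.State} {e : E} :
    e ∈ removed ψ ↔ ∃ p : G.SimplePath, ∃ x : p.edges, ψ p = some x ∧ (x : E) = e := by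
  simp [removed]

theorem removed_update {ψ : G.State} {p : G.SimplePath} (hp : ψ p = none) (x : p.edges) :
    removed (Function.update ψ p (some x)) = insert (x : E) (removed ψ) := by
  ext e
  rw [Finset.mem_insert, mem_removed, mem_removed]
  constructor
  · rintro ⟨r, y, hy, rfl⟩
    by_cases h : r = p
    · subst h
      rw [Function.update_self, Option.some.injEq] at hy
      exact Or.inl (by rw [hy])
    · rw [Function.update_of_ne h] at hy
      exact Or.inr ⟨r, y, hy, rfl⟩
  · rintro (rfl | ⟨r, y, hy, rfl⟩)
    · exact ⟨p, x, Function.update_self .., rfl⟩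
    · refine ⟨r, y, ?_, rfl⟩
      rw [Function.update_of_ne, hy]
      rintro rfl
      simp [hp] at hy

theorem exists_unproposed_of_not_isCut {ψ : G.State} (h : ¬ G.IsCut (removed ψ)) :
    ∃ p, ψ p = none ∧ ∀ e ∈ p.edges, e ∉ removed ψ := by
  simp only [IsCut, not_forall, not_exists, not_and] at h
  obtain ⟨p, hp⟩ := h
  refine ⟨p, ?_, hp⟩
  by_contra hne
  obtain ⟨x, hx⟩ := Option.ne_none_iff_exists'.mp hne
  exact hp x x.2 (mem_removed.mpr ⟨p, x, hx, rfl⟩)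

/-- The number of paths that have not been proposed yet. -/
noncomputable def numUnproposed (ψ : G.State) : ℕ := (univ.filter fun p => ψ p = none).card

theorem numUnproposed_update {ψ : G.State} {p : G.SimplePath} (hp : ψ p = none) (x : p.edges) :
    numUnproposed (Function.update ψ p (some x)) + 1 = numUnproposed ψ := by
  have : (univ.filter fun r => Function.update ψ p (some x) r = none) =
      (univ.filter fun r => ψ r = none).erase p := by
    ext r
    by_cases h : r = p
    · subst h
      simp
    · simp [h]
  rw [numUnproposed, this, numUnproposed]
  exact Finset.card_erase_add_one (by simpa using hp)

theorem isCut_of_numUnproposed_eq_zero {ψ : G.State} (h : numUnproposed ψ = 0) :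
    G.IsCut (removed ψ) := by
  by_contra hc
  obtain ⟨p, hp, -⟩ := exists_unproposed_of_not_isCut hc
  rw [numUnproposed, Finset.card_eq_zero] at h
  have : p ∈ (univ.filter fun r => ψ r = none) := by simpa using hp
  simp [h] at this

/-! ### Gains -/

theorem gain_eq (ψ : G.State) (p : G.SimplePath) :
    gain ψ p = ∑ x : p.edges, G.edgeProb p x * G.marginal (removed ψ) x :=
  (Finset.sum_coe_sort p.edges fun e => G.edgeProb p e * G.marginal (removed ψ) e).symm

theorem gain_nonneg (hconf : ∀ e : E, 0 ≤ G.conf e) (ψ : G.State) (p : G.SimplePath) :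
    0 ≤ gain ψ p := by
  rw [gain_eq]
  exact Finset.sum_nonneg fun x _ => mul_nonneg (edgeProb_nonneg hconf _ _) (marginal_nonneg _ _)

theorem gain_le_card (hconf : ∀ e : E, 0 ≤ G.conf e)
    (hpos : ∀ p : G.SimplePath, 0 < ∑ e ∈ p.edges, G.conf e) (ψ : G.State) (p : G.SimplePath) :
    gain ψ p ≤ Fintype.card G.SimplePath := by
  rw [gain_eq, ← one_mul (Fintype.card G.SimplePath : ℝ), ← sum_edgeProb hpos p, Finset.sum_mul]
  exact Finset.sum_le_sum fun x _ =>
    mul_le_mul_of_nonneg_left (marginal_le_card _ _) (edgeProb_nonneg hconf _ _)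

/-- Adaptive submodularity. -/
theorem gain_update_le (hconf : ∀ e : E, 0 ≤ G.conf e) {ψ : G.State} {r : G.SimplePath}
    (hr : ψ r = none) (x : r.edges) (p : G.SimplePath) :
    gain (Function.update ψ r (some x)) p ≤ gain ψ p := by
  rw [gain_eq, gain_eq, removed_update hr]
  exact Finset.sum_le_sum fun y _ => mul_le_mul_of_nonneg_left
    (marginal_anti (Finset.subset_insert _ _) _) (edgeProb_nonneg hconf _ _)

namespace Policy

theorem IsGreedy.isAdmissible {π : G.Policy} (hπ : π.IsGreedy) : π.IsAdmissible :=
  fun ψ hψ => (hπ ψ hψ).1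

/-- Before there is a cut, some surviving path has not been proposed, and every answer to it
destroys at least that path. -/
theorem IsGreedy.one_le_gain {π : G.Policy} (hπ : π.IsGreedy) (hconf : ∀ e : E, 0 ≤ G.conf e)
    (hpos : ∀ p : G.SimplePath, 0 < ∑ e ∈ p.edges, G.conf e) {ψ : G.State}
    (hψ : ¬ G.IsCut (removed ψ)) : 1 ≤ gain ψ (π ψ) := by
  obtain ⟨p, hp, hsurv⟩ := exists_unproposed_of_not_isCut hψ
  refine le_trans ?_ ((hπ ψ hψ).2 p hp)
  rw [gain_eq, ← sum_edgeProb hpos p]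
  exact Finset.sum_le_sum fun x _ =>
    le_mul_of_one_le_right (edgeProb_nonneg hconf _ _) (one_le_marginal hsurv x.2)

/-- The greedy price per destroyed path: the query costs `1` and is expected to destroy
`gain ψ (π ψ)` paths. Before there is a cut this gain is at least `1`, so it is not a division
by zero. -/
noncomputable def price (π : G.Policy) (ψ : G.State) : ℝ := (gain ψ (π ψ))⁻¹

/-- The greedy gains decrease along a run, so the prices increase. -/
theorem IsGreedy.price_le_price_update {π : G.Policy} (hπ : π.IsGreedy)
    (hconf : ∀ e : E, 0 ≤ G.conf e)
    (hpos : ∀ p : G.SimplePath, 0 < ∑ e ∈ p.edges, G.conf e) {ψ : G.State}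
    (hψ : ¬ G.IsCut (removed ψ)) (x : (π ψ).edges)
    (hψ' : ¬ G.IsCut (removed (Function.update ψ (π ψ) (some x)))) :
    π.price ψ ≤ π.price (Function.update ψ (π ψ) (some x)) := by
  have h1 := hπ.one_le_gain hconf hpos hψ'
  refine inv_anti₀ (by linarith) ?_
  refine (gain_update_le hconf (hπ ψ hψ).1 x _).trans ((hπ ψ hψ).2 _ ?_)
  have h2 := (hπ _ hψ').1
  by_cases h : π (Function.update ψ (π ψ) (some x)) = π ψ
  · rw [h]
    exact (hπ ψ hψ).1
  · rwa [Function.update_of_ne h] at h2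

end Policy

/-! ### Answers drawn in advance -/

/-- A full realization: the answer to every path, whether or not it is ever proposed. -/
abbrev Answers (G : AttackGraph V E) : Type _ := (p : G.SimplePath) → p.edges

/-- The probability of a full realization: the answers are independent. -/
noncomputable def Answers.prob (φ : G.Answers) : ℝ := ∏ p, G.edgeProb p (φ p)

theorem Answers.prob_nonneg (hconf : ∀ e : E, 0 ≤ G.conf e) (φ : G.Answers) : 0 ≤ φ.prob :=
  Finset.prod_nonneg fun _ _ => edgeProb_nonneg hconf _ _

theorem sum_prob_resample (hpos : ∀ p : G.SimplePath, 0 < ∑ e ∈ p.edges, G.conf e)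
    (j : G.SimplePath) (F : G.Answers → ℝ) :
    ∑ φ : G.Answers, φ.prob * F φ =
      ∑ φ : G.Answers, φ.prob * ∑ x : j.edges, G.edgeProb j x * F (Function.update φ j x) :=
  sum_prod_mul_resample (α := fun p : G.SimplePath => p.edges) (fun p x => G.edgeProb p x)
    (fun p => sum_edgeProb hpos p) j F

theorem sum_prob (hpos : ∀ p : G.SimplePath, 0 < ∑ e ∈ p.edges, G.conf e) :
    ∑ φ : G.Answers, φ.prob = 1 := by
  simp only [Answers.prob]
  rw [← Fintype.prod_sum (κ := fun p : G.SimplePath => p.edges) fun p x => G.edgeProb p x]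
  exact Finset.prod_eq_one fun p _ => sum_edgeProb hpos p

/-- The state after one more query of the policy, answered according to `φ`. -/
noncomputable def Policy.next (π : G.Policy) (φ : G.Answers) (ψ : G.State) : G.State :=
  Function.update ψ (π ψ) (some (φ (π ψ)))

namespace Policy

open Classical in
/-- The sum of the rewards `r ψ p x` (for receiving the answer `x` to the path `p` in the state
`ψ`) over the run of the policy on the answers `φ`, from the state `ψ` on and with budget `B`. -/
noncomputable def total (π : G.Policy) (r : G.State → (p : G.SimplePath) → p.edges → ℝ) :
    ℕ → G.State → G.Answers → ℝ
  | 0, _, _ => 0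
  | B + 1, ψ, φ =>
    if G.IsCut (removed ψ) then 0
    else r ψ (π ψ) (φ (π ψ)) + total π r B (π.next φ ψ) φ

variable {π : G.Policy} {r : G.State → (p : G.SimplePath) → p.edges → ℝ}

theorem total_of_isCut {B : ℕ} {ψ : G.State} (h : G.IsCut (removed ψ)) (φ : G.Answers) :
    π.total r B ψ φ = 0 := by
  cases B <;> simp [total, h]

theorem total_succ {B : ℕ} {ψ : G.State} (h : ¬ G.IsCut (removed ψ)) (φ : G.Answers) :
    π.total r (B + 1) ψ φ = r ψ (π ψ) (φ (π ψ)) + π.total r B (π.next φ ψ) φ := by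
  simp [total, h]

/-- The answer to a path that has been proposed already is never looked up again. -/
theorem IsAdmissible.total_update (hπ : π.IsAdmissible) (j : G.SimplePath) (x : j.edges)
    (φ : G.Answers) (B : ℕ) (ψ : G.State) (hj : ψ j ≠ none) :
    π.total r B ψ (Function.update φ j x) = π.total r B ψ φ := by
  induction B generalizing ψ with
  | zero => rfl
  | succ B ih =>
    by_cases h : G.IsCut (removed ψ)
    · rw [total_of_isCut h, total_of_isCut h]
    · have hne : π ψ ≠ j := fun h' => hj (h' ▸ hπ ψ h)
      rw [total_succ h, total_succ h]
      simp only [next, Function.update_of_ne hne]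
      rw [ih _ (by rwa [Function.update_of_ne hne.symm])]

/-- If every query brings an expected reward of `1`, then the expected total reward is the expected
number of queries. -/
theorem IsAdmissible.sum_prob_mul_total (hπ : π.IsAdmissible)
    (hpos : ∀ p : G.SimplePath, 0 < ∑ e ∈ p.edges, G.conf e)
    (hr : ∀ ψ : G.State, ¬ G.IsCut (removed ψ) →
      ∑ x : (π ψ).edges, G.edgeProb (π ψ) x * r ψ (π ψ) x = 1) (B : ℕ) (ψ : G.State) :
    ∑ φ : G.Answers, φ.prob * π.total r B ψ φ = π.expectedQueries B ψ := by
  induction B generalizing ψ with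
  | zero => simp [total, expectedQueries]
  | succ B ih =>
    by_cases h : G.IsCut (removed ψ)
    · simp [total, expectedQueries, h]
    · have key : ∀ φ : G.Answers,
          ∑ x : (π ψ).edges, G.edgeProb (π ψ) x * π.total r (B + 1) ψ (Function.update φ (π ψ) x) =
            1 + ∑ x : (π ψ).edges, G.edgeProb (π ψ) x *
              π.total r B (Function.update ψ (π ψ) (some x)) φ := by
        intro φ
        rw [← hr ψ h, ← Finset.sum_add_distrib]
        refine Finset.sum_congr rfl fun x _ => ?_
        rw [total_succ h, next, Function.update_self,
          hπ.total_update _ _ _ _ _ (by simp), mul_add]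
      rw [sum_prob_resample hpos (π ψ)]
      simp only [key, mul_add, mul_one, Finset.sum_add_distrib, sum_prob hpos, Finset.mul_sum]
      rw [Finset.sum_comm]
      simp only [expectedQueries, h, if_false]
      congr 1
      refine Finset.sum_congr rfl fun x _ => ?_
      rw [← ih, Finset.mul_sum]
      exact Finset.sum_congr rfl fun φ _ => by ring

/-! ### The paths proposed by a policy -/

open Classical in
/-- The number of times that `j` is proposed (at most once, for an admissible policy). -/
noncomputable def proposed (σ : G.Policy) (j : G.SimplePath) : ℕ → G.State → G.Answers → ℝ :=
  σ.total fun _ p _ => if p = j then 1 else 0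

variable {σ : G.Policy}

theorem proposed_of_isCut {j : G.SimplePath} {B : ℕ} {ψ : G.State} (h : G.IsCut (removed ψ))
    (φ : G.Answers) : σ.proposed j B ψ φ = 0 :=
  total_of_isCut h φ

open Classical in
theorem proposed_succ {j : G.SimplePath} {B : ℕ} {ψ : G.State} (h : ¬ G.IsCut (removed ψ))
    (φ : G.Answers) : σ.proposed j (B + 1) ψ φ =
      (if σ ψ = j then 1 else 0) + σ.proposed j B (σ.next φ ψ) φ :=
  total_succ h φ

theorem proposed_nonneg (j : G.SimplePath) (B : ℕ) (ψ : G.State) (φ : G.Answers) :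
    0 ≤ σ.proposed j B ψ φ := by
  induction B generalizing ψ with
  | zero => exact le_rfl
  | succ B ih =>
    by_cases h : G.IsCut (removed ψ)
    · rw [proposed_of_isCut h]
    · rw [proposed_succ h]
      have := ih (σ.next φ ψ)
      split_ifs <;> linarith

theorem total_one_eq_sum_proposed (B : ℕ) (ψ : G.State) (φ : G.Answers) :
    σ.total (fun _ _ _ => 1) B ψ φ = ∑ j, σ.proposed j B ψ φ := by
  induction B generalizing ψ with
  | zero => simp [total, proposed]
  | succ B ih =>
    by_cases h : G.IsCut (removed ψ)
    · simp [total_of_isCut h, proposed_of_isCut h]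
    · simp only [total_succ h, proposed_succ h, Finset.sum_add_distrib, ih]
      simp

theorem sum_prob_mul_proposed (hσ : σ.IsAdmissible)
    (hpos : ∀ p : G.SimplePath, 0 < ∑ e ∈ p.edges, G.conf e) (B : ℕ) (ψ : G.State) :
    ∑ j, ∑ φ : G.Answers, φ.prob * σ.proposed j B ψ φ = σ.expectedQueries B ψ := by
  rw [Finset.sum_comm, ← hσ.sum_prob_mul_total (r := fun _ _ _ => 1) hpos
    (fun ψ _ => by simpa only [mul_one] using sum_edgeProb hpos _)]
  simp only [total_one_eq_sum_proposed, Finset.mul_sum]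

/-- Whether `j` is proposed does not depend on the answer to `j`. -/
theorem IsAdmissible.proposed_update (hσ : σ.IsAdmissible) (j : G.SimplePath) (x : j.edges)
    (φ : G.Answers) (B : ℕ) (ψ : G.State) (hj : ψ j = none) :
    σ.proposed j B ψ (Function.update φ j x) = σ.proposed j B ψ φ := by
  have hzero : ∀ (B : ℕ) (ψ : G.State) (φ : G.Answers), ψ j ≠ none →
      σ.proposed j B ψ φ = 0 := by
    intro B
    induction B with
    | zero => exact fun _ _ _ => rfl
    | succ B ih =>
      intro ψ φ hj
      by_cases h : G.IsCut (removed ψ)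
      · rw [proposed_of_isCut h]
      · have hne : σ ψ ≠ j := fun h' => hj (h' ▸ hσ ψ h)
        rw [proposed_succ h, if_neg hne, zero_add]
        exact ih _ _ (by rwa [next, Function.update_of_ne hne.symm])
  induction B generalizing ψ with
  | zero => rfl
  | succ B ih =>
    by_cases h : G.IsCut (removed ψ)
    · rw [proposed_of_isCut h, proposed_of_isCut h]
    · rw [proposed_succ h, proposed_succ h]
      congr 1
      by_cases hne : σ ψ = j
      · subst hne
        rw [hzero _ _ _ (by simp [next]), hzero _ _ _ (by simp [next])]
      · simp only [next, Function.update_of_ne hne]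
        exact ih _ (by rwa [Function.update_of_ne (Ne.symm hne)])

/-- With enough budget, the answers to the proposed paths complete the removed edges to a cut. -/
theorem IsAdmissible.exists_proposed (hσ : σ.IsAdmissible) (φ : G.Answers) (B : ℕ) (ψ : G.State)
    (hB : numUnproposed ψ ≤ B) (p : G.SimplePath) :
    (∃ e ∈ p.edges, e ∈ removed ψ) ∨
      ∃ j, 1 ≤ σ.proposed j B ψ φ ∧ (φ j : E) ∈ p.edges := by
  induction B generalizing ψ with
  | zero => exact Or.inl (isCut_of_numUnproposed_eq_zero (Nat.le_zero.mp hB) p)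
  | succ B ih =>
    by_cases h : G.IsCut (removed ψ)
    · exact Or.inl (h p)
    · have hnone := hσ ψ h
      have hcard := numUnproposed_update hnone (φ (σ ψ))
      rcases ih (σ.next φ ψ) (by rw [next]; omega) with ⟨e, hep, he⟩ | ⟨j, hj, hjp⟩
      · rw [next, removed_update hnone, Finset.mem_insert] at he
        rcases he with rfl | he
        · refine Or.inr ⟨σ ψ, ?_, hep⟩
          rw [proposed_succ h, if_pos rfl]
          linarith [proposed_nonneg (σ := σ) (σ ψ) B (σ.next φ ψ) φ]
        · exact Or.inl ⟨e, hep, he⟩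
      · refine Or.inr ⟨j, ?_, hjp⟩
        rw [proposed_succ h]
        split_ifs <;> linarith

/-- The answers that `σ` receives form a cut, so together they destroy all the paths that survive
the removal of any set `C`. -/
theorem IsAdmissible.card_sub_utility_le (hσ : σ.IsAdmissible) (φ : G.Answers) (C : Finset E) :
    (Fintype.card G.SimplePath : ℝ) - G.utility C ≤
      ∑ j, σ.proposed j (Fintype.card G.SimplePath) G.root φ * G.marginal C (φ j) := by
  classical
  set q : G.SimplePath → ℝ := fun j => σ.proposed j (Fintype.card G.SimplePath) G.root φ with hq
  set J : Finset G.SimplePath := univ.filter fun j => 1 ≤ q j with hJ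
  have hsub : univ \ C.biUnion G.pathsThrough ⊆
      J.biUnion fun j => G.pathsThrough (φ j) \ C.biUnion G.pathsThrough := by
    intro p hp
    rcases hσ.exists_proposed φ (Fintype.card G.SimplePath) G.root
      (Finset.card_le_univ _) p with ⟨e, -, he⟩ | ⟨j, hj, hjp⟩
    · obtain ⟨_, _, h, -⟩ := mem_removed.mp he
      simp [root] at h
    · rw [Finset.mem_biUnion]
      refine ⟨j, by simpa [hJ] using hj, Finset.mem_sdiff.mpr ⟨?_, (Finset.mem_sdiff.mp hp).2⟩⟩
      simpa [pathsThrough] using hjp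
  have hcard : (univ \ C.biUnion G.pathsThrough).card + G.utility C =
      Fintype.card G.SimplePath := by
    rw [utility, Finset.card_sdiff_add_card_eq_card (Finset.subset_univ _), Finset.card_univ]
  have h1 : ((univ \ C.biUnion G.pathsThrough).card : ℝ) ≤
      ∑ j ∈ J, G.marginal C (φ j) := by
    simp only [marginal_eq_card]
    exact_mod_cast (Finset.card_le_card hsub).trans Finset.card_biUnion_le
  have h2 : ∑ j ∈ J, G.marginal C (φ j) ≤ ∑ j ∈ J, q j * G.marginal C (φ j) :=
    Finset.sum_le_sum fun j hj =>
      le_mul_of_one_le_left (marginal_nonneg _ _) (Finset.mem_filter.mp hj).2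
  have h3 : ∑ j ∈ J, q j * G.marginal C (φ j) ≤ ∑ j, q j * G.marginal C (φ j) :=
    Finset.sum_le_sum_of_subset_of_nonneg (Finset.subset_univ _) fun j _ _ =>
      mul_nonneg (proposed_nonneg _ _ _ _) (marginal_nonneg _ _)
  have h4 : ((univ \ C.biUnion G.pathsThrough).card : ℝ) + G.utility C =
      Fintype.card G.SimplePath := by
    exact_mod_cast hcard
  linarith

/-! ### Charging the greedy payments to the paths of the other policy -/

open Classical in
/-- The charge of the path `j` over the run of `π` on `φ` from the state `ψ` on, if `c` is the price
before `ψ`: in each state, the price increment times the number of surviving paths that the answer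
`φ j` would destroy. -/
noncomputable def charge (π : G.Policy) (j : G.SimplePath) :
    ℕ → ℝ → G.State → G.Answers → ℝ
  | 0, _, _, _ => 0
  | B + 1, c, ψ, φ =>
    if G.IsCut (removed ψ) then 0
    else (π.price ψ - c) * G.marginal (removed ψ) (φ j) +
      charge π j B (π.price ψ) (π.next φ ψ) φ

theorem charge_of_isCut {j : G.SimplePath} {B : ℕ} {c : ℝ} {ψ : G.State}
    (h : G.IsCut (removed ψ)) (φ : G.Answers) : π.charge j B c ψ φ = 0 := by
  cases B <;> simp [charge, h]

theorem charge_succ {j : G.SimplePath} {B : ℕ} {c : ℝ} {ψ : G.State}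
    (h : ¬ G.IsCut (removed ψ)) (φ : G.Answers) :
    π.charge j (B + 1) c ψ φ = (π.price ψ - c) * G.marginal (removed ψ) (φ j) +
      π.charge j B (π.price ψ) (π.next φ ψ) φ := by
  simp [charge, h]

/-- The amount paid by the greedy policy for an answer `x`. -/
noncomputable def payment (π : G.Policy) (ψ : G.State) (p : G.SimplePath) (x : p.edges) : ℝ :=
  π.price ψ * G.marginal (removed ψ) x

/-- Summation by parts. If the weights `q` of the answers `φ j` cover the surviving paths of every
state, then the greedy payments beyond the price `c` are at most the weighted sum of the charges. -/
theorem IsGreedy.total_payment_sub_le (hπ : π.IsGreedy) (hconf : ∀ e : E, 0 ≤ G.conf e)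
    (hpos : ∀ p : G.SimplePath, 0 < ∑ e ∈ p.edges, G.conf e) (φ : G.Answers)
    (q : G.SimplePath → ℝ)
    (hq : ∀ C : Finset E, (Fintype.card G.SimplePath : ℝ) - G.utility C ≤
      ∑ j, q j * G.marginal C (φ j)) (B : ℕ) (c : ℝ) (ψ : G.State) (hB : numUnproposed ψ ≤ B)
    (hc : ¬ G.IsCut (removed ψ) → c ≤ π.price ψ) :
    π.total π.payment B ψ φ - c * ((Fintype.card G.SimplePath : ℝ) - G.utility (removed ψ)) ≤
      ∑ j, q j * π.charge j B c ψ φ := by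
  induction B generalizing ψ c with
  | zero =>
    have h : G.IsCut (removed ψ) := isCut_of_numUnproposed_eq_zero (Nat.le_zero.mp hB)
    simp [total, charge, utility_of_isCut h]
  | succ B ih =>
    by_cases h : G.IsCut (removed ψ)
    · simp [total_of_isCut h, charge_of_isCut h, utility_of_isCut h]
    · have hnone := (hπ ψ h).1
      have hcard := numUnproposed_update hnone (φ (π ψ))
      have hrem : removed (π.next φ ψ) = insert (φ (π ψ) : E) (removed ψ) :=
        removed_update hnone _
      have ih' := ih (π.price ψ) (π.next φ ψ) (by rw [next]; omega)
        (hπ.price_le_price_update hconf hpos h _)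
      have hcov := mul_le_mul_of_nonneg_left (hq (removed ψ)) (sub_nonneg.mpr (hc h))
      have hsum : ∑ j, q j * π.charge j (B + 1) c ψ φ =
          (π.price ψ - c) * ∑ j, q j * G.marginal (removed ψ) (φ j) +
            ∑ j, q j * π.charge j B (π.price ψ) (π.next φ ψ) φ := by
        rw [Finset.mul_sum, ← Finset.sum_add_distrib]
        exact Finset.sum_congr rfl fun j _ => by rw [charge_succ h]; ring
      rw [hrem] at ih'
      rw [hsum, total_succ h, payment, marginal]
      linarith

/-- In expectation, the greedy policy pays `1` per query. -/
theorem IsGreedy.sum_prob_mul_total_payment (hπ : π.IsGreedy) (hconf : ∀ e : E, 0 ≤ G.conf e)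
    (hpos : ∀ p : G.SimplePath, 0 < ∑ e ∈ p.edges, G.conf e) (B : ℕ) (ψ : G.State) :
    ∑ φ : G.Answers, φ.prob * π.total π.payment B ψ φ = π.expectedQueries B ψ := by
  refine hπ.isAdmissible.sum_prob_mul_total hpos (fun ψ hψ => ?_) B ψ
  have h1 := hπ.one_le_gain hconf hpos hψ
  have h2 : ∑ x : (π ψ).edges, G.edgeProb (π ψ) x * π.payment ψ (π ψ) x = π.price ψ * gain ψ (π ψ) := by
    rw [gain_eq, Finset.mul_sum]
    exact Finset.sum_congr rfl fun x _ => by rw [payment]; ring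
  rw [h2, price, inv_mul_cancel₀ (by linarith)]

/-! ### The expected charge of a path -/

/-- No more charges once the answer `φ j` is among the removed edges. -/
theorem IsAdmissible.charge_eq_zero (hπ : π.IsAdmissible) (j : G.SimplePath) (φ : G.Answers)
    (B : ℕ) (c : ℝ) (ψ : G.State) (hj : (φ j : E) ∈ removed ψ) : π.charge j B c ψ φ = 0 := by
  induction B generalizing ψ c with
  | zero => rfl
  | succ B ih =>
    by_cases h : G.IsCut (removed ψ)
    · exact charge_of_isCut h φ
    · rw [charge_succ h, marginal_of_mem hj, mul_zero, zero_add]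
      refine ih _ _ ?_
      rw [next, removed_update (hπ ψ h)]
      exact Finset.mem_insert_of_mem hj

/-- One step of the greedy run, with the answer to `j` averaged out. Either `j` is proposed now and
gets no further charge, or the next state does not depend on the answer to `j`. -/
theorem IsAdmissible.sum_charge_succ (hπ : π.IsAdmissible) (j : G.SimplePath) (φ : G.Answers)
    (B : ℕ) (c : ℝ) {ψ : G.State} (h : ¬ G.IsCut (removed ψ)) :
    ∑ x : j.edges, G.edgeProb j x * π.charge j (B + 1) c ψ (Function.update φ j x) =
      (π.price ψ - c) * gain ψ j + (if π ψ = j then 0 else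
        ∑ x : j.edges, G.edgeProb j x *
          π.charge j B (π.price ψ) (π.next φ ψ) (Function.update φ j x)) := by
  have h1 : ∀ x : j.edges, G.edgeProb j x * π.charge j (B + 1) c ψ (Function.update φ j x) =
      (π.price ψ - c) * (G.edgeProb j x * G.marginal (removed ψ) x) +
        (if π ψ = j then 0 else G.edgeProb j x *
          π.charge j B (π.price ψ) (π.next φ ψ) (Function.update φ j x)) := by
    intro x
    rw [charge_succ h, Function.update_self]
    split_ifs with hj
    · have hmem : ((Function.update φ j x) j : E) ∈
          removed (π.next (Function.update φ j x) ψ) := by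
        rw [next, removed_update (hπ ψ h), hj]
        exact Finset.mem_insert_self _ _
      rw [hπ.charge_eq_zero j _ _ _ _ hmem]
      ring
    · simp only [next, Function.update_of_ne hj]
      ring
  simp only [h1, Finset.sum_add_distrib, ← Finset.mul_sum, gain_eq]
  split_ifs <;> simp

theorem IsGreedy.sub_mul_gain_le (hπ : π.IsGreedy) (hconf : ∀ e : E, 0 ≤ G.conf e)
    (hpos : ∀ p : G.SimplePath, 0 < ∑ e ∈ p.edges, G.conf e) {ψ : G.State}
    (h : ¬ G.IsCut (removed ψ)) {j : G.SimplePath} (hj : ψ j = none) {c : ℝ}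
    (hc : c ≤ π.price ψ) : (π.price ψ - c) * gain ψ j ≤ 1 - c / π.price ψ := by
  have h1 := hπ.one_le_gain hconf hpos h
  refine (mul_le_mul_of_nonneg_left ((hπ ψ h).2 j hj) (sub_nonneg.mpr hc)).trans_eq ?_
  rw [price, div_inv_eq_mul, sub_mul, inv_mul_cancel₀ (by linarith)]

/-- Each increment of the price from `c` to `θ` contributes at most `1 - c / θ ≤ log θ - log c`, and
the price does not exceed `1`. -/
theorem IsGreedy.sum_charge_le_neg_log (hπ : π.IsGreedy) (hconf : ∀ e : E, 0 ≤ G.conf e)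
    (hpos : ∀ p : G.SimplePath, 0 < ∑ e ∈ p.edges, G.conf e) (j : G.SimplePath)
    (φ : G.Answers) (B : ℕ) (c : ℝ) (ψ : G.State) (hj : ψ j = none) (hc0 : 0 < c) (hc1 : c ≤ 1)
    (hc : ¬ G.IsCut (removed ψ) → c ≤ π.price ψ) :
    ∑ x : j.edges, G.edgeProb j x * π.charge j B c ψ (Function.update φ j x) ≤ -Real.log c := by
  have hlog : ∀ {d : ℝ}, 0 < d → d ≤ 1 → 0 ≤ -Real.log d := fun h0 h1 =>
    neg_nonneg.mpr (Real.log_nonpos h0.le h1)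
  induction B generalizing ψ c with
  | zero => simpa [charge] using hlog hc0 hc1
  | succ B ih =>
    by_cases h : G.IsCut (removed ψ)
    · simpa [charge_of_isCut h] using hlog hc0 hc1
    · have hg := hπ.one_le_gain hconf hpos h
      have hθ0 : 0 < π.price ψ := inv_pos.mpr (by linarith)
      have hθ1 : π.price ψ ≤ 1 := inv_le_one_of_one_le₀ hg
      rw [hπ.isAdmissible.sum_charge_succ j φ B c h]
      have h1 := hπ.sub_mul_gain_le hconf hpos h hj (hc h)
      have h2 : 1 - c / π.price ψ ≤ Real.log (π.price ψ) - Real.log c := by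
        have := Real.log_le_sub_one_of_pos (div_pos hc0 hθ0)
        rw [Real.log_div hc0.ne' hθ0.ne'] at this
        linarith
      have h3 : (if π ψ = j then 0 else ∑ x : j.edges, G.edgeProb j x *
          π.charge j B (π.price ψ) (π.next φ ψ) (Function.update φ j x)) ≤
          -Real.log (π.price ψ) := by
        split_ifs with hne
        · exact hlog hθ0 hθ1
        · exact ih _ _ (by rwa [next, Function.update_of_ne (Ne.symm hne)]) hθ0 hθ1
            (hπ.price_le_price_update hconf hpos h _)
      linarith

/-- The first price, which is an increment from `0`, contributes at most `1`; it is at least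
`1 / |P|`, so the later increments contribute at most `log |P|`. -/
theorem IsGreedy.sum_charge_root_le (hπ : π.IsGreedy) (hconf : ∀ e : E, 0 ≤ G.conf e)
    (hpos : ∀ p : G.SimplePath, 0 < ∑ e ∈ p.edges, G.conf e) (j : G.SimplePath)
    (φ : G.Answers) (B : ℕ) :
    ∑ x : j.edges, G.edgeProb j x * π.charge j B 0 G.root (Function.update φ j x) ≤
      Real.log (Fintype.card G.SimplePath) + 1 := by
  have hlogn : 0 ≤ Real.log (Fintype.card G.SimplePath) := Real.log_natCast_nonneg _
  cases B with
  | zero => simpa [charge] using by linarith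
  | succ B =>
    by_cases h : G.IsCut (removed G.root)
    · simpa [charge_of_isCut h] using by linarith
    · have hg := hπ.one_le_gain hconf hpos h
      have hθ0 : 0 < π.price G.root := inv_pos.mpr (by linarith)
      have hθ1 : π.price G.root ≤ 1 := inv_le_one_of_one_le₀ hg
      rw [hπ.isAdmissible.sum_charge_succ j φ B 0 h]
      have h1 := hπ.sub_mul_gain_le hconf hpos h (j := j) rfl hθ0.le
      rw [zero_div] at h1
      have h2 : -Real.log (π.price G.root) ≤ Real.log (Fintype.card G.SimplePath) := by
        rw [price, Real.log_inv, neg_neg]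
        exact Real.log_le_log (by linarith) (gain_le_card hconf hpos _ _)
      have h3 : (if π G.root = j then 0 else ∑ x : j.edges, G.edgeProb j x *
          π.charge j B (π.price G.root) (π.next φ G.root) (Function.update φ j x)) ≤
          Real.log (Fintype.card G.SimplePath) := by
        split_ifs with hne
        · exact hlogn
        · refine le_trans (hπ.sum_charge_le_neg_log hconf hpos j φ B _ _ ?_ hθ0 hθ1
            (hπ.price_le_price_update hconf hpos h _)) h2
          rw [next, Function.update_of_ne (Ne.symm hne)]
          rfl
      linarith

/-- The bound with the factor `log |P| + 1`. -/
theorem IsGreedy.expectedQueries_le (hπ : π.IsGreedy) (hσ : σ.IsAdmissible)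
    (hconf : ∀ e : E, 0 ≤ G.conf e)
    (hpos : ∀ p : G.SimplePath, 0 < ∑ e ∈ p.edges, G.conf e) :
    π.expectedQueries (Fintype.card G.SimplePath) G.root ≤
      (Real.log (Fintype.card G.SimplePath : ℝ) + 1) *
        σ.expectedQueries (Fintype.card G.SimplePath) G.root := by
  rw [← hπ.sum_prob_mul_total_payment hconf hpos, ← sum_prob_mul_proposed hσ hpos]
  set n := Fintype.card G.SimplePath with hn
  calc ∑ φ : G.Answers, φ.prob * π.total π.payment n G.root φ
      ≤ ∑ φ : G.Answers, φ.prob * ∑ j, σ.proposed j n G.root φ * π.charge j n 0 G.root φ := by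
        refine Finset.sum_le_sum fun φ _ =>
          mul_le_mul_of_nonneg_left ?_ (φ.prob_nonneg hconf)
        have := hπ.total_payment_sub_le hconf hpos φ _ (hσ.card_sub_utility_le φ) n 0 G.root
          (Finset.card_le_univ _) fun h => inv_nonneg.mpr (gain_nonneg hconf _ _)
        rwa [zero_mul, sub_zero] at this
    _ = ∑ j, ∑ φ : G.Answers, φ.prob *
          (σ.proposed j n G.root φ * π.charge j n 0 G.root φ) := by
        rw [Finset.sum_comm]
        simp only [Finset.mul_sum]
    _ = ∑ j, ∑ φ : G.Answers, φ.prob * (σ.proposed j n G.root φ *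
          ∑ x : j.edges, G.edgeProb j x * π.charge j n 0 G.root (Function.update φ j x)) := by
        refine Finset.sum_congr rfl fun j _ => ?_
        rw [sum_prob_resample hpos j]
        refine Finset.sum_congr rfl fun φ _ => ?_
        congr 1
        rw [Finset.mul_sum]
        refine Finset.sum_congr rfl fun x _ => ?_
        rw [hσ.proposed_update j x φ n G.root rfl]
        ring
    _ ≤ ∑ j, ∑ φ : G.Answers, φ.prob * (σ.proposed j n G.root φ * (Real.log n + 1)) :=
        Finset.sum_le_sum fun j _ => Finset.sum_le_sum fun φ _ =>
          mul_le_mul_of_nonneg_left (mul_le_mul_of_nonneg_left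
            (hπ.sum_charge_root_le hconf hpos j φ n) (proposed_nonneg _ _ _ _))
            (φ.prob_nonneg hconf)
    _ = (Real.log n + 1) * ∑ j, ∑ φ : G.Answers, φ.prob * σ.proposed j n G.root φ := by
        simp only [Finset.mul_sum]
        exact Finset.sum_congr rfl fun j _ => Finset.sum_congr rfl fun φ _ => by ring

end Policy

end AttackGraph

theorem theorem2 {V E : Type*} [Fintype E] [DecidableEq E] (G : AttackGraph V E)
    (hst : G.s ≠ G.t)
    (hconf : ∀ e : E, G.conf e ∈ Set.Icc (0 : ℝ) 1)
    (hpos : ∀ p : G.SimplePath, 0 < ∑ e ∈ p.edges, G.conf e)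
    (π : G.Policy) (hπ : π.IsGreedy)
    (σ : G.Policy) (hσ : σ.IsAdmissible) :
    π.expectedQueries (Fintype.card G.SimplePath) G.root ≤
      (Real.log (Fintype.card G.SimplePath : ℝ) + 1) ^ 2 *
        σ.expectedQueries (Fintype.card G.SimplePath) G.root := by
  have hc : ∀ e : E, 0 ≤ G.conf e := fun e => (hconf e).1
  refine (hπ.expectedQueries_le hσ hc hpos).trans (mul_le_mul_of_nonneg_right ?_ ?_)
  · have := Real.log_natCast_nonneg (Fintype.card G.SimplePath)
    exact le_self_pow₀ (by linarith) two_ne_zero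
  · rw [← AttackGraph.Policy.sum_prob_mul_proposed hσ hpos]
    exact Finset.sum_nonneg fun j _ => Finset.sum_nonneg fun φ _ =>
      mul_nonneg (φ.prob_nonneg hc) (AttackGraph.Policy.proposed_nonneg _ _ _ _)
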